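/- Let $k$ be an algebraically closed field of characteristic $p>0$, with Frobenius automorphism $\sigma\colon x\mapsto x^p$. A \emph{Hasse--Witt triple} (HW-triple) over $k$ is a triple $(Q,\Phi,\Psi)$ consisting of a finite dimensional $k$-vector space $Q$, a $\sigma$-linear map $\Phi\colon Q\to Q$, and a $\sigma$-linear bijection $\Psi\colon \operatorname{Ker}(\Phi)\to \operatorname{Im}(\Phi)^\perp$, where $\operatorname{Im}(\Phi)^\perp=\{\lambda\in Q^\vee \mid \lambda(q)=0 \text{ for all } q\in\operatorname{Im}(\Phi)\}$. Let $(Q_1,\Phi_1,\Psi_1)$ and $(Q_2,\Phi_2,\Psi_2)$ be HW-triples over $k$. They are called \emph{equivalent} if there exist a $k$-linear bijection $f\colon Q_1\to Q_2$ and constants $c,d\in k^*$ such that $$\Phi_2\circ f = c\cdot (f\circ\Phi_1)\qquad\text{and}\qquad \Psi_2\circ f|_{\operatorname{Ker}(\Phi_1)} = d\cdot \bigl((f^{\vee})^{-1}\circ\Psi_1\bigr),$$ where $f^\vee\colon Q_2^\vee\to Q_1^\vee$ is the dual map of $f$. They are called \emph{isomorphic} if there exists such an $f$ with $c=d=1$.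 If two HW-triples over $k$ are equivalent, then they are isomorphic. -/

import Mathlib

/-- Over a perfect ring of characteristic `p` the Frobenius `σ = frobenius k p` is surjective, so
that the image of a `σ`-linear map is a submodule. -/
instance HWTriple.frobenius_ringHomSurjective (p : ℕ) (k : Type*) [Field k] [ExpChar k p]
    [PerfectRing k p] : RingHomSurjective (frobenius k p) :=
  ⟨(bijective_frobenius k p).surjective⟩

/-- A Hasse–Witt triple `(Q, Φ, Ψ)` over a perfect field `k` of characteristic `p > 0`, on a finite
dimensional `k`-vector space `Q`. With `σ` the Frobenius of `k`, `Φ : Q → Q` is `σ`-linear and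
`Ψ : Ker Φ → (Im Φ)^⊥ ⊆ Q^∨` is `σ`-linear and bijective. -/
structure HWTriple (p : ℕ) [Fact p.Prime] (k : Type*) [Field k] [CharP k p] [PerfectRing k p]
    (Q : Type*) [AddCommGroup Q] [Module k Q] [FiniteDimensional k Q] where
  /-- The `σ`-linear endomorphism. -/
  Φ : Q →ₛₗ[frobenius k p] Q
  /-- The `σ`-linear map from the kernel of `Φ` to the annihilator of the image of `Φ`. -/
  Ψ : LinearMap.ker Φ →ₛₗ[frobenius k p] (LinearMap.range Φ).dualAnnihilator
  bijective_Ψ : Function.Bijective Ψ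

namespace HWTriple

variable {p : ℕ} [Fact p.Prime] {k : Type*} [Field k] [CharP k p] [PerfectRing k p]
  {Q₁ Q₂ : Type*} [AddCommGroup Q₁] [Module k Q₁] [FiniteDimensional k Q₁]
  [AddCommGroup Q₂] [Module k Q₂] [FiniteDimensional k Q₂]

/-- If `Φ₂ ∘ f = c • (f ∘ Φ₁)` then `f` maps `Ker Φ₁` to `Ker Φ₂`. -/
theorem map_mem_ker {T₁ : HWTriple p k Q₁} {T₂ : HWTriple p k Q₂} {f : Q₁ ≃ₗ[k] Q₂} {c : k}
    (h : ∀ x, T₂.Φ (f x) = c • f (T₁.Φ x)) (x : LinearMap.ker T₁.Φ) :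
    f x ∈ LinearMap.ker T₂.Φ := by
  have hx : T₁.Φ x = 0 := x.2
  rw [LinearMap.mem_ker, h, hx, map_zero, smul_zero]

/-- `f` satisfies `Φ₂ ∘ f = c • (f ∘ Φ₁)` and `Ψ₂ ∘ f = d • (f^{∨,-1} ∘ Ψ₁)`; the second identity is
one between maps `Ker Φ₁ → Q₂^∨`. -/
def Intertwines (T₁ : HWTriple p k Q₁) (T₂ : HWTriple p k Q₂) (c d : k) (f : Q₁ ≃ₗ[k] Q₂) : Prop :=
  ∃ h : ∀ x, T₂.Φ (f x) = c • f (T₁.Φ x),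
    ∀ x : LinearMap.ker T₁.Φ,
      (T₂.Ψ ⟨f x, map_mem_ker h x⟩ : Module.Dual k Q₂) =
        d • f.dualMap.symm (T₁.Ψ x : Module.Dual k Q₁)

/-- Two HW-triples are equivalent if some linear bijection respects `Φ` and `Ψ` up to nonzero
scalars. -/
def Equivalent (T₁ : HWTriple p k Q₁) (T₂ : HWTriple p k Q₂) : Prop :=
  ∃ (f : Q₁ ≃ₗ[k] Q₂) (c d : k), c ≠ 0 ∧ d ≠ 0 ∧ T₁.Intertwines T₂ c d f

/-- Two HW-triples are isomorphic if some linear bijection satisfies `Φ₂ ∘ f = f ∘ Φ₁` and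
`Ψ₂ ∘ f = f^{∨,-1} ∘ Ψ₁`. -/
def Isomorphic (T₁ : HWTriple p k Q₁) (T₂ : HWTriple p k Q₂) : Prop :=
  ∃ f : Q₁ ≃ₗ[k] Q₂, T₁.Intertwines T₂ 1 1 f

end HWTriple

/-! It suffices to show that rescaling `Φ` by `c` and `Ψ` by `d` does not change the isomorphism
class (`HWTriple.exists_equiv_rescale`); composing with an equivalence then removes its constants.

Starting from the chain 0 ⊂ Q, apply L ↦ Φ(L) and L ↦ (Ψ(L ∩ Ker Φ))^⊥ until the chain is stable. On
the stable chain `Φ` and `Ψ` relate graded pieces to graded pieces, so an automorphism acting by a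
scalar a(B) on each piece B/A intertwines the two structures to leading order once a(ΦB) = c·a(B)^p
and a(A')·a(B)^p = d, for A' the annihilator attached to A, wherever the induced graded map is
nonzero. All exponents are ±p, so the exponent matrix is the identity mod p; its determinant is
nonzero, and roots in the algebraically closed field solve the system (`exists_units_eq_mul_zpow`,
`HWTriple.exists_scalars`).

The lower order error is removed by going back through the refinements. If g is correct modulo the
refinement of E, then g ∘ u is correct modulo E for a suitable u that is the identity on graded
pieces (`HWTriple.IsIsoMod.exists_of_refine`). Modulo {0, Q} the error terms lie in 0, so the
automorphism obtained there is exact. -/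

section Chains

/-! ### Chains of subspaces and endomorphisms with prescribed graded pieces -/

variable {k V : Type*} [Field k] [AddCommGroup V] [Module k V]

/-- `A` and `B` belong to `D`, and no member of `D` lies strictly between them. When `D` is a chain
this means that `B ≤ A` or that `B` is the successor of `A`. -/
def ChainAdj (D : Set (Submodule k V)) (A B : Submodule k V) : Prop :=
  A ∈ D ∧ B ∈ D ∧ ∀ C ∈ D, C ≤ A ∨ B ≤ C

variable {D : Set (Submodule k V)}

theorem ChainAdj.refl (hD : IsChain (· ≤ ·) D) {L : Submodule k V} (hL : L ∈ D) :
    ChainAdj D L L :=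
  ⟨hL, hL, fun _ hC => hD.total hC hL⟩

variable [FiniteDimensional k V]

/-- Every nonzero member of a chain containing `⊥` has a predecessor. -/
theorem exists_chainAdj_lt (hD : IsChain (· ≤ ·) D) (hbot : ⊥ ∈ D) {L : Submodule k V}
    (hL : L ∈ D) (h0 : L ≠ ⊥) : ∃ A, ChainAdj D A L ∧ A < L := by
  obtain ⟨A, ⟨hA, hAL⟩, hmax⟩ := wellFounded_gt.has_min {A | A ∈ D ∧ A < L}
    ⟨⊥, hbot, bot_lt_iff_ne_bot.2 h0⟩
  refine ⟨A, ⟨hA, hL, fun C hC => ?_⟩, hAL⟩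
  rcases hD.total hL hC with h | h
  · exact Or.inr h
  · rcases h.lt_or_eq with h | h
    · rcases hD.total hC hA with h' | h'
      · exact Or.inl h'
      · rcases h'.lt_or_eq with h'' | h''
        · exact absurd h'' (hmax C ⟨hC, h⟩)
        · exact Or.inl h''.ge
    · exact Or.inr h.ge

theorem finrank_injOn_chain (hD : IsChain (· ≤ ·) D) :
    Set.InjOn (fun L : Submodule k V => Module.finrank k L) D := by
  intro A hA B hB h
  rcases hD.total hA hB with h' | h'
  · exact Submodule.eq_of_le_of_finrank_eq h' h
  · exact (Submodule.eq_of_le_of_finrank_eq h' h.symm).symm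

theorem finite_of_isChain (hD : IsChain (· ≤ ·) D) : D.Finite :=
  Set.Finite.of_finite_image
    ((Set.finite_Iic (Module.finrank k V)).subset (by
      rintro _ ⟨L, -, rfl⟩
      exact Submodule.finrank_le L)) (finrank_injOn_chain hD)

/-- A subspace has a complement that is adapted to all members of a given chain. -/
theorem exists_isCompl_adapted (hD : IsChain (· ≤ ·) D) (hbot : ⊥ ∈ D) (htop : ⊤ ∈ D)
    (K : Submodule k V) :
    ∃ W : Submodule k V, IsCompl K W ∧ ∀ L ∈ D, L ≤ (L ⊓ K) ⊔ (L ⊓ W) := by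
  have key : ∀ L : Submodule k V, L ∈ D → ∃ W : Submodule k V, W ≤ L ∧ Disjoint K W ∧
      ∀ M ∈ D, M ≤ L → M ≤ (M ⊓ K) ⊔ (M ⊓ W) := by
    intro L
    induction L using WellFoundedLT.induction with
    | ind L ih =>
      intro hL
      by_cases h0 : L = ⊥
      · subst h0
        exact ⟨⊥, le_rfl, disjoint_bot_right, fun M _ h => h.trans bot_le⟩
      obtain ⟨A, hA, hAL⟩ := exists_chainAdj_lt hD hbot hL h0
      obtain ⟨W, hWA, hKW, hW⟩ := ih A hAL hA.1
      -- Extend `W` to a complement of `L ⊓ K` in the whole space; its trace on `L` complements `L ⊓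
      -- K` in `L`.
      obtain ⟨W', hWW', hc⟩ := (hKW.mono_left (inf_le_right : L ⊓ K ≤ K)).symm.exists_isCompl
      refine ⟨L ⊓ W', inf_le_left, ?_, fun M hM hML => ?_⟩
      · rw [disjoint_iff, ← inf_assoc, inf_comm K L]
        exact hc.symm.inf_eq_bot
      · rcases hA.2.2 M hM with h | h
        · exact (hW M hM h).trans (sup_le_sup_left
            (inf_le_inf_left _ (le_inf (hWA.trans hAL.le) hWW')) _)
        · obtain rfl := le_antisymm hML h
          intro x hx
          have hx' : x ∈ (M ⊓ K) ⊔ W' := hc.symm.sup_eq_top ▸ Submodule.mem_top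
          obtain ⟨y, hy, z, hz, rfl⟩ := Submodule.mem_sup.1 hx'
          refine Submodule.add_mem_sup hy ⟨?_, ?_, hz⟩ <;>
          · simpa using M.sub_mem hx hy.1
  obtain ⟨W, -, hKW, hW⟩ := key ⊤ htop
  refine ⟨W, ⟨hKW, codisjoint_iff_le_sup.2 ?_⟩, fun L hL => hW L hL le_top⟩
  simpa using hW ⊤ htop le_top

/-- An endomorphism acting by nonzero scalars on the graded pieces of a chain is injective. -/
theorem injective_of_chain_scalar (hD : IsChain (· ≤ ·) D) (hbot : ⊥ ∈ D) (htop : ⊤ ∈ D)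
    (u : V →ₗ[k] V) (a : Submodule k V → k) (ha : ∀ L, a L ≠ 0)
    (hu : ∀ A B, ChainAdj D A B → A < B → ∀ x ∈ B, u x - a B • x ∈ A) :
    Function.Injective u := by
  rw [← LinearMap.ker_eq_bot, eq_bot_iff]
  intro x hx
  obtain ⟨L, ⟨hL, hxL⟩, hmin⟩ := wellFounded_lt.has_min {L | L ∈ D ∧ x ∈ L}
    ⟨⊤, htop, Submodule.mem_top⟩
  by_cases h0 : L = ⊥
  · exact h0 ▸ hxL
  obtain ⟨A, hA, hAL⟩ := exists_chainAdj_lt hD hbot hL h0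
  have h := hu A L hA hAL x hxL
  rw [LinearMap.mem_ker.1 hx, zero_sub, neg_mem_iff, Submodule.smul_mem_iff _ (ha L)] at h
  exact absurd hAL (hmin A ⟨hA.1, h⟩)

/-- Prescribed scalars on the graded pieces of a chain are realised by an endomorphism that
stabilises a given subspace. -/
theorem exists_chain_scalar (hD : IsChain (· ≤ ·) D) (hbot : ⊥ ∈ D) (htop : ⊤ ∈ D)
    (K : Submodule k V) (a : Submodule k V → k) :
    ∃ g : V →ₗ[k] V, (∀ x ∈ K, g x ∈ K) ∧
      ∀ A B, ChainAdj D A B → A < B → ∀ x ∈ B, g x - a B • x ∈ A := by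
  have key : ∀ L : Submodule k V, L ∈ D → ∃ g : V →ₗ[k] V, (∀ x ∈ K, g x ∈ K) ∧
      (∀ x ∈ L, g x ∈ L) ∧
      ∀ A B, ChainAdj D A B → A < B → B ≤ L → ∀ x ∈ B, g x - a B • x ∈ A := by
    intro L
    induction L using WellFoundedLT.induction with
    | ind L ih =>
      intro hL
      by_cases h0 : L = ⊥
      · subst h0
        exact ⟨LinearMap.id, fun x hx => hx, fun x hx => hx,
          fun A B _ hAB hB => absurd (hAB.trans_le hB) not_lt_bot⟩
      obtain ⟨A, hA, hAL⟩ := exists_chainAdj_lt hD hbot hL h0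
      obtain ⟨g, hgK, hgA, hg⟩ := ih A hAL hA.1
      -- A complement of `A` adapted to `K` gives a projection onto `A` that preserves `K`. Keep the
      -- old `g` on `A` and act by `a L` on the complement.
      have hch : IsChain (· ≤ ·) ({⊥, K, ⊤} : Set (Submodule k V)) := by
        rintro X (rfl | rfl | rfl) Y (rfl | rfl | rfl) - <;> simp
      obtain ⟨W, hW, hWK⟩ := exists_isCompl_adapted hch (by simp) (by simp) A
      have hπ : ∀ x, A.projection W hW x ∈ A := fun x => by simp
      have hπA : ∀ x ∈ A, A.projection W hW x = x := fun x hx =>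
        Submodule.projection_apply_left hW ⟨x, hx⟩
      have hπK : ∀ x ∈ K, A.projection W hW x ∈ K := by
        intro x hx
        obtain ⟨y, hy, z, hz, rfl⟩ := Submodule.mem_sup.1 (hWK K (by simp) hx)
        rw [map_add, hπA y hy.2, Submodule.projection_apply_of_mem_right hW hz.2, add_zero]
        exact hy.1
      obtain ⟨g', hg'⟩ : ∃ g' : V →ₗ[k] V, ∀ x, g' x =
          g (A.projection W hW x) + a L • (x - A.projection W hW x) :=
        ⟨g ∘ₗ A.projection W hW + a L • (LinearMap.id - A.projection W hW), fun x => rfl⟩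
      have hgL : ∀ x, g' x - a L • x ∈ A := by
        intro x
        have : g' x - a L • x = g (A.projection W hW x) - a L • A.projection W hW x := by
          rw [hg', smul_sub]
          abel
        rw [this]
        exact A.sub_mem (hgA _ (hπ x)) (A.smul_mem _ (hπ x))
      refine ⟨g', ?_, ?_, ?_⟩
      · intro x hx
        rw [hg']
        exact K.add_mem (hgK _ (hπK x hx)) (K.smul_mem _ (K.sub_mem hx (hπK x hx)))
      · intro x hx
        have := L.add_mem (hAL.le (hgL x)) (L.smul_mem (a L) hx)
        rwa [sub_add_cancel] at this
      · intro A' B hAB hlt hBL x hx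
        rcases hA.2.2 B hAB.2.1 with h | h
        · have := hg A' B hAB hlt h x hx
          simpa [hg', hπA x (h hx)] using this
        · obtain rfl := le_antisymm hBL h
          rcases hAB.2.2 A hA.1 with h' | h'
          · exact h' (hgL x)
          · exact absurd hAL h'.not_gt
  obtain ⟨g, hK, -, hg⟩ := key ⊤ htop
  exact ⟨g, hK, fun A B h h' => hg A B h h' le_top⟩

theorem chain_mem_of_scalar (hD : IsChain (· ≤ ·) D) (hbot : ⊥ ∈ D)
    {g : V →ₗ[k] V} {a : Submodule k V → k}
    (hg : ∀ A B, ChainAdj D A B → A < B → ∀ x ∈ B, g x - a B • x ∈ A)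
    {L : Submodule k V} (hL : L ∈ D) {x : V} (hx : x ∈ L) : g x ∈ L := by
  by_cases h0 : L = ⊥
  · subst h0
    simp [(Submodule.mem_bot k).1 hx]
  obtain ⟨A, hA, hAL⟩ := exists_chainAdj_lt hD hbot hL h0
  have := L.add_mem (hAL.le (hg A L hA hAL x hx)) (L.smul_mem (a L) hx)
  rwa [sub_add_cancel] at this

theorem LinearEquiv.apply_mem_iff_of_stable (g : V ≃ₗ[k] V) {L : Submodule k V}
    (h : ∀ x ∈ L, g x ∈ L) (x : V) : g x ∈ L ↔ x ∈ L := by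
  refine ⟨fun hx => ?_, h x⟩
  have hle : L.map (g : V →ₗ[k] V) ≤ L := by
    rintro _ ⟨y, hy, rfl⟩
    exact h y hy
  have heq : L.map (g : V →ₗ[k] V) = L :=
    Submodule.eq_of_le_of_finrank_eq hle (LinearEquiv.finrank_map_eq g L)
  rw [← heq] at hx
  obtain ⟨y, hy, hyx⟩ := hx
  exact g.injective hyx ▸ hy

end Chains

/-! ### Multiplicative systems of equations -/

/-- Over an algebraically closed field, a system `a i = t i * a (s i) ^ e i` on a finite index set
is solvable in units as soon as all exponents are divisible by some prime. -/
theorem exists_units_eq_mul_zpow {k : Type*} [Field k] [IsAlgClosed k] {ι : Type*} [Finite ι]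
    (p : ℕ) [Fact p.Prime] (s : ι → ι) (e : ι → ℤ) (he : ∀ i, (p : ℤ) ∣ e i) (t : ι → kˣ) :
    ∃ a : ι → kˣ, ∀ i, a i = t i * a (s i) ^ e i := by
  classical
  cases nonempty_fintype ι
  let S : Matrix ι ι ℤ := Matrix.of fun i j => if j = s i then e i else 0
  let M : Matrix ι ι ℤ := 1 - S
  have hdet : M.det ≠ 0 := by
    intro h0
    -- Modulo `p` the matrix `S` vanishes, so `M.det` is 1 mod `p`.
    have h1 : (Int.castRingHom (ZMod p)).mapMatrix M = 1 := by
      ext i j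
      have : ((e i : ℤ) : ZMod p) = 0 := (ZMod.intCast_zmod_eq_zero_iff_dvd _ _).2 (he i)
      simp [M, S, Matrix.one_apply, apply_ite (Int.cast : ℤ → ZMod p), this]
    have h2 := (Int.castRingHom (ZMod p)).map_det M
    rw [h1, h0] at h2
    simp at h2
  have hroot : ∀ x : kˣ, ∃ y : kˣ, y ^ M.det = x := by
    intro x
    obtain ⟨z, hz⟩ := IsAlgClosed.exists_pow_nat_eq (x : k) (Int.natAbs_pos.2 hdet)
    have hz0 : z ≠ 0 := by
      rintro rfl
      rw [zero_pow (Int.natAbs_pos.2 hdet).ne'] at hz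
      exact x.ne_zero hz.symm
    have hu : (Units.mk0 z hz0) ^ M.det.natAbs = x := Units.ext (by simpa using hz)
    rcases Int.natAbs_eq M.det with h | h
    · exact ⟨Units.mk0 z hz0, by rw [h, zpow_natCast, hu]⟩
    · exact ⟨(Units.mk0 z hz0)⁻¹, by rw [h, zpow_neg, inv_zpow, inv_inv, zpow_natCast, hu]⟩
  choose r hr using hroot
  -- Cramer's rule written multiplicatively: `r` takes a root of order `M.det`, which replaces
  -- division by the determinant.
  let a : ι → kˣ := fun j => ∏ l, r (t l) ^ M.adjugate j l
  have ha : ∀ i, ∏ j, a j ^ M i j = t i := by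
    intro i
    calc ∏ j, a j ^ M i j = ∏ j, ∏ l, r (t l) ^ (M i j * M.adjugate j l) := by
          refine Finset.prod_congr rfl fun j _ => ?_
          rw [← Finset.prod_zpow]
          exact Finset.prod_congr rfl fun l _ => by rw [← zpow_mul, mul_comm]
      _ = ∏ l, r (t l) ^ (M * M.adjugate) i l := by
          rw [Finset.prod_comm]
          refine Finset.prod_congr rfl fun l _ => ?_
          rw [Matrix.mul_apply]
          exact (map_sum (zpowersHom kˣ (r (t l)) |>.toAdditiveRight) _ _).symm
      _ = t i := by
          rw [Matrix.mul_adjugate, Finset.prod_eq_single i]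
          · simp [hr]
          · intro l _ hl
            simp [hl.symm]
          · simp
  refine ⟨a, fun i => ?_⟩
  have h : ∏ j, a j ^ M i j = a i / a (s i) ^ e i := by
    have : ∀ j, a j ^ M i j =
        (if i = j then a j else 1) / (if j = s i then a j ^ e i else 1) := by
      intro j
      simp only [M, S, Matrix.sub_apply, Matrix.one_apply, Matrix.of_apply, zpow_sub]
      split_ifs <;> simp [div_eq_mul_inv]
    simp only [this, Finset.prod_div_distrib]
    simp
  rw [ha] at h
  rw [h, div_mul_cancel]

/-! ### Annihilators under `Ψ` and refinement of chains -/

namespace HWTriple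

variable {p : ℕ} [Fact p.Prime] {k : Type*} [Field k] [CharP k p] [PerfectRing k p]
  {Q : Type*} [AddCommGroup Q] [Module k Q] [FiniteDimensional k Q]

/-- The subspace of all `y` such that `Ψ x y = 0` for all `x` in `L ∩ Ker Φ`. -/
def annSub (T : HWTriple p k Q) (L : Submodule k Q) : Submodule k Q where
  carrier := {y | ∀ x : LinearMap.ker T.Φ, (x : Q) ∈ L → (T.Ψ x : Module.Dual k Q) y = 0}
  add_mem' := fun ha hb x hx => by rw [map_add, ha x hx, hb x hx, add_zero]
  zero_mem' := fun x _ => map_zero _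
  smul_mem' := fun a y hy x hx => by rw [map_smul, hy x hx, smul_zero]

variable (T : HWTriple p k Q)

theorem annSub_antitone : Antitone T.annSub :=
  fun _ _ h _ hy x hx => hy x (h hx)

theorem Ψ_apply_Φ (x : LinearMap.ker T.Φ) (y : Q) :
    (T.Ψ x : Module.Dual k Q) (T.Φ y) = 0 :=
  (Submodule.mem_dualAnnihilator _).1 (T.Ψ x).2 _ (LinearMap.mem_range_self _ y)

/-- `Ψ` takes values in the annihilator of Im Φ. Hence every image under `Φ` lies below every
annihilator, which is why a refined chain is again a chain. -/
theorem map_le_annSub (L M : Submodule k Q) : L.map T.Φ ≤ T.annSub M := by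
  rintro _ ⟨y, -, rfl⟩ x -
  exact T.Ψ_apply_Φ x y

theorem annSub_bot : T.annSub ⊥ = ⊤ := by
  refine eq_top_iff.2 fun y _ x hx => ?_
  have : x = 0 := Subtype.ext ((Submodule.mem_bot k).1 hx)
  simp [this]

theorem Ψ_injective {x y : LinearMap.ker T.Φ}
    (h : (T.Ψ x : Module.Dual k Q) = T.Ψ y) : x = y :=
  T.bijective_Ψ.1 (Subtype.ext h)

/-- A functional vanishing on `annSub L` is of the form `Ψ z` with `z` in `L ∩ Ker Φ`. -/
theorem exists_Ψ_eq {L : Submodule k Q} (φ : Module.Dual k Q) (h : ∀ y ∈ T.annSub L, φ y = 0) :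
    ∃ z : LinearMap.ker T.Φ, (z : Q) ∈ L ∧ (T.Ψ z : Module.Dual k Q) = φ := by
  let S : Submodule k (Module.Dual k Q) :=
    ((L.comap (LinearMap.ker T.Φ).subtype).map T.Ψ).map
      (LinearMap.range T.Φ).dualAnnihilator.subtype
  have hS : φ ∈ S.dualCoannihilator.dualAnnihilator := by
    rw [Submodule.mem_dualAnnihilator]
    intro y hy
    refine h y fun x hx => ?_
    exact (Submodule.mem_dualCoannihilator _).1 hy _ ⟨T.Ψ x, ⟨x, hx, rfl⟩, rfl⟩
  rw [Subspace.dualCoannihilator_dualAnnihilator_eq] at hS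
  obtain ⟨_, ⟨z, hz, rfl⟩, rfl⟩ := hS
  exact ⟨z, hz, rfl⟩

theorem mem_of_Ψ_eq_zero {L : Submodule k Q} {x : LinearMap.ker T.Φ}
    (h : ∀ y ∈ T.annSub L, (T.Ψ x : Module.Dual k Q) y = 0) : (x : Q) ∈ L := by
  obtain ⟨z, hz, hzx⟩ := T.exists_Ψ_eq _ h
  rwa [← T.Ψ_injective hzx]

/-- The refinement of a chain `D` obtained by transport along `Φ` and `Ψ`. -/
def refine (D : Set (Submodule k Q)) : Set (Submodule k Q) :=
  (fun L => L.map T.Φ) '' D ∪ T.annSub '' D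

variable {T} {D E : Set (Submodule k Q)}

theorem map_mem_refine {L : Submodule k Q} (hL : L ∈ D) : L.map T.Φ ∈ T.refine D :=
  Or.inl ⟨L, hL, rfl⟩

theorem annSub_mem_refine {L : Submodule k Q} (hL : L ∈ D) : T.annSub L ∈ T.refine D :=
  Or.inr ⟨L, hL, rfl⟩

theorem refine_mono : Monotone T.refine := fun _ _ h =>
  Set.union_subset_union (Set.image_mono h) (Set.image_mono h)

theorem bot_mem_refine (h : ⊥ ∈ D) : ⊥ ∈ T.refine D := by
  simpa using map_mem_refine (T := T) h

theorem top_mem_refine (h : ⊥ ∈ D) : ⊤ ∈ T.refine D := by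
  simpa [annSub_bot] using annSub_mem_refine (T := T) h

theorem isChain_refine (hD : IsChain (· ≤ ·) D) : IsChain (· ≤ ·) (T.refine D) := by
  rintro _ (⟨A, hA, rfl⟩ | ⟨A, hA, rfl⟩) _ (⟨B, hB, rfl⟩ | ⟨B, hB, rfl⟩) -
  · exact (hD.total hA hB).imp (fun h => Submodule.map_mono h) fun h => Submodule.map_mono h
  · exact Or.inl (T.map_le_annSub A B)
  · exact Or.inr (T.map_le_annSub B A)
  · exact (hD.total hB hA).imp (fun h => T.annSub_antitone h) fun h => T.annSub_antitone h

theorem chainAdj_map {A B : Submodule k Q} (h : ChainAdj D A B) :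
    ChainAdj (T.refine D) (A.map T.Φ) (B.map T.Φ) := by
  refine ⟨map_mem_refine h.1, map_mem_refine h.2.1, ?_⟩
  rintro _ (⟨L, hL, rfl⟩ | ⟨L, hL, rfl⟩)
  · exact (h.2.2 L hL).imp (fun h => Submodule.map_mono h) fun h => Submodule.map_mono h
  · exact Or.inr (T.map_le_annSub B L)

theorem chainAdj_annSub {A B : Submodule k Q} (h : ChainAdj D A B) :
    ChainAdj (T.refine D) (T.annSub B) (T.annSub A) := by
  refine ⟨annSub_mem_refine h.2.1, annSub_mem_refine h.1, ?_⟩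
  rintro _ (⟨L, hL, rfl⟩ | ⟨L, hL, rfl⟩)
  · exact Or.inl (T.map_le_annSub L B)
  · exact (h.2.2 L hL).symm.imp (fun h => T.annSub_antitone h) fun h => T.annSub_antitone h

/-! ### Automorphisms up to lower order and their correction -/

/-- `g` respects the chain `D`, and satisfies `g ∘ Φ = c • Φ ∘ g` and `g^∨ ∘ Ψ ∘ g = d • Ψ` up to
terms of lower order with respect to `D`. -/
structure IsIsoMod (T : HWTriple p k Q) (c d : k) (D : Set (Submodule k Q)) (g : Q ≃ₗ[k] Q) :
    Prop where
  ker_mem : ∀ x ∈ LinearMap.ker T.Φ, g x ∈ LinearMap.ker T.Φ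
  apply_mem : ∀ L ∈ D, ∀ x ∈ L, g x ∈ L
  Φ_mem : ∀ A B, ChainAdj D A B → ∀ x ∈ B, g (T.Φ x) - c • T.Φ (g x) ∈ A.map T.Φ
  Ψ_mem : ∀ A B, ChainAdj D A B → ∀ x x' : LinearMap.ker T.Φ, (x : Q) ∈ B → (x' : Q) = g x →
    ∃ z : LinearMap.ker T.Φ, (z : Q) ∈ A ∧ ∀ y,
      d * (T.Ψ x : Module.Dual k Q) y - (T.Ψ x' : Module.Dual k Q) (g y) =
        (T.Ψ z : Module.Dual k Q) y

/-- If `g` is an isomorphism modulo `T.refine E`, then it can be corrected to one modulo `E`. -/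
theorem IsIsoMod.exists_of_refine {c d : k} (hc : c ≠ 0) (hE : IsChain (· ≤ ·) E) (hbot : ⊥ ∈ E)
    (htop : ⊤ ∈ E) (hsub : E ⊆ T.refine E) {g : Q ≃ₗ[k] Q} (hg : T.IsIsoMod c d (T.refine E) g) :
    ∃ g' : Q ≃ₗ[k] Q, T.IsIsoMod c d E g' := by
  have hD : IsChain (· ≤ ·) (T.refine E) := isChain_refine hE
  have hDbot : ⊥ ∈ T.refine E := bot_mem_refine hbot
  have hDtop : ⊤ ∈ T.refine E := top_mem_refine hbot
  have hgK := g.apply_mem_iff_of_stable hg.ker_mem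
  have hgL := fun L hL => g.apply_mem_iff_of_stable (hg.apply_mem L hL)
  obtain ⟨W, hW, hWD⟩ := exists_isCompl_adapted hD hDbot hDtop (LinearMap.ker T.Φ)
  have hW0 : ∀ x ∈ LinearMap.ker T.Φ, x ∈ W → x = 0 := fun x hx hx' =>
    (Submodule.mem_bot k).1 (hW.inf_eq_bot ▸ ⟨hx, hx'⟩)
  let gK : LinearMap.ker T.Φ → LinearMap.ker T.Φ := fun x => ⟨g x, hg.ker_mem x x.2⟩
  -- the correction on the kernel of `Φ`
  have hexK : ∀ x : LinearMap.ker T.Φ, ∃ m : LinearMap.ker T.Φ, ∀ y,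
      (T.Ψ (gK m) : Module.Dual k Q) (g y) = d * (T.Ψ x : Module.Dual k Q) y := by
    intro x
    -- `g` preserves Im Φ, a member of the refined chain, so `φ` kills Im Φ and is a value of `Ψ`.
    let φ : Module.Dual k Q := d • ((T.Ψ x : Module.Dual k Q) ∘ₗ (g.symm : Q →ₗ[k] Q))
    have hφ : φ ∈ (LinearMap.range T.Φ).dualAnnihilator := by
      rw [Submodule.mem_dualAnnihilator]
      rintro _ ⟨y, rfl⟩
      have h1 : g.symm (T.Φ y) ∈ (⊤ : Submodule k Q).map T.Φ := by
        rw [← hgL _ (map_mem_refine htop), LinearEquiv.apply_symm_apply]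
        exact ⟨y, trivial, rfl⟩
      obtain ⟨w, -, hw⟩ := h1
      simp [φ, ← hw, T.Ψ_apply_Φ]
    obtain ⟨n, hn⟩ := T.bijective_Ψ.2 ⟨φ, hφ⟩
    refine ⟨⟨g.symm n, by rw [← hgK, LinearEquiv.apply_symm_apply]; exact n.2⟩, fun y => ?_⟩
    have : gK ⟨g.symm n, by rw [← hgK, LinearEquiv.apply_symm_apply]; exact n.2⟩ = n :=
      Subtype.ext (by simp [gK])
    rw [this, hn]
    simp [φ]
  have hunK : ∀ m m' : LinearMap.ker T.Φ, (∀ y, (T.Ψ (gK m) : Module.Dual k Q) (g y) =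
      (T.Ψ (gK m') : Module.Dual k Q) (g y)) → m = m' := by
    intro m m' h
    have h1 : gK m = gK m' := T.Ψ_injective (LinearMap.ext fun y => by
      simpa using h (g.symm y))
    exact Subtype.ext (g.injective (congrArg Subtype.val h1))
  have hgK_add : ∀ m m', gK (m + m') = gK m + gK m' := fun m m' => Subtype.ext (map_add g _ _)
  have hgK_smul : ∀ (a : k) m, gK (a • m) = a • gK m := fun a m => Subtype.ext (map_smul g _ _)
  choose uK' huK' using hexK
  obtain ⟨uK, huK⟩ : ∃ uK : LinearMap.ker T.Φ →ₗ[k] LinearMap.ker T.Φ, ∀ x y,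
      (T.Ψ (gK (uK x)) : Module.Dual k Q) (g y) = d * (T.Ψ x : Module.Dual k Q) y := by
    refine ⟨⟨⟨uK', fun x x' => hunK _ _ fun y => ?_⟩, fun a x => hunK _ _ fun y => ?_⟩, huK'⟩
    · simp [hgK_add, huK', mul_add]
    · simp [hgK_smul, huK', mul_left_comm]
  -- the correction on the complement
  have hexW : ∀ x : Q, ∃ m ∈ W, c • T.Φ (g m) = g (T.Φ x) := by
    intro x
    have h1 : c⁻¹ • g (T.Φ x) ∈ (⊤ : Submodule k Q).map T.Φ :=
      Submodule.smul_mem _ _ (hg.apply_mem _ (map_mem_refine htop) _ ⟨x, trivial, rfl⟩)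
    obtain ⟨w, -, hw⟩ := h1
    have h2 : g.symm w ∈ LinearMap.ker T.Φ ⊔ W := hW.sup_eq_top ▸ Submodule.mem_top
    obtain ⟨z, hz, m, hm, hzm⟩ := Submodule.mem_sup.1 h2
    refine ⟨m, hm, ?_⟩
    have h3 : T.Φ (g m) = T.Φ w := by
      have h4 : w = g z + g m := by rw [← map_add, hzm, LinearEquiv.apply_symm_apply]
      rw [h4, map_add, LinearMap.mem_ker.1 (hg.ker_mem z hz), zero_add]
    rw [h3, hw, smul_inv_smul₀ hc]
  have hunW : ∀ m ∈ W, ∀ m' ∈ W, c • T.Φ (g m) = c • T.Φ (g m') → m = m' := by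
    intro m hm m' hm' h
    have h1 : T.Φ (g (m - m')) = 0 := by
      rw [map_sub, map_sub, smul_right_injective Q hc h, sub_self]
    exact sub_eq_zero.1 (hW0 _ ((hgK _).1 h1) (W.sub_mem hm hm'))
  choose uW' huW' huW'' using hexW
  obtain ⟨uW, huWW, huW⟩ : ∃ uW : Q →ₗ[k] Q, (∀ x, uW x ∈ W) ∧
      ∀ x, c • T.Φ (g (uW x)) = g (T.Φ x) := by
    refine ⟨⟨⟨uW', fun x x' => hunW _ (huW' _) _ (W.add_mem (huW' _) (huW' _)) ?_⟩,
      fun a x => hunW _ (huW' _) _ (W.smul_mem _ (huW' _)) ?_⟩, huW', huW''⟩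
    · simp [huW'']
    · simp only [RingHom.id_apply, huW'', map_smul, LinearMap.map_smulₛₗ]
      rw [smul_comm c, huW'']
  have huW_ker : ∀ x ∈ LinearMap.ker T.Φ, uW x = 0 := by
    intro x hx
    refine hunW _ (huWW x) 0 W.zero_mem ?_
    rw [huW, LinearMap.mem_ker.1 hx]
    simp
  -- the total correction
  obtain ⟨u, hu⟩ : ∃ u : Q →ₗ[k] Q, ∀ (x : LinearMap.ker T.Φ), ∀ y ∈ W,
      u (x + y) = uK x + uW y := by
    refine ⟨(LinearMap.ker T.Φ).subtype ∘ₗ uK ∘ₗ Submodule.projectionOnto _ W hW + uW,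
      fun x y hy => ?_⟩
    simp [huW_ker x x.2, Submodule.projectionOnto_apply_of_mem_right hW hy]
  have hu_ker : ∀ x : LinearMap.ker T.Φ, u x = uK x := fun x => by
    simpa using hu x 0 W.zero_mem
  have huΦ : ∀ x, c • T.Φ (g (u x)) = g (T.Φ x) := by
    intro x
    have hx : x ∈ LinearMap.ker T.Φ ⊔ W := hW.sup_eq_top ▸ Submodule.mem_top
    obtain ⟨z, hz, m, hm, rfl⟩ := Submodule.mem_sup.1 hx
    rw [hu ⟨z, hz⟩ m hm, map_add, map_add, LinearMap.mem_ker.1 (hg.ker_mem _ (uK _).2), zero_add,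
      huW, map_add, LinearMap.mem_ker.1 hz, zero_add]
  -- `T.annSub A` need not belong to `T.refine E`; its stability comes from the degenerate pair `A,
  -- A` in `Ψ_mem`.
  have hann : ∀ A ∈ T.refine E, ∀ y ∈ T.annSub A, g y ∈ T.annSub A := by
    intro A hA y hy x hx
    have hx' : g.symm x ∈ LinearMap.ker T.Φ := by
      rw [← hgK, LinearEquiv.apply_symm_apply]; exact x.2
    have hxA : g.symm x ∈ A := by
      rwa [← hgL A hA, LinearEquiv.apply_symm_apply]
    obtain ⟨z, hz, h⟩ := hg.Ψ_mem A A (ChainAdj.refl hD hA) ⟨_, hx'⟩ x hxA (by simp)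
    have := h y
    rwa [hy _ hxA, hy _ hz, mul_zero, zero_sub, neg_eq_zero] at this
  have hulow : ∀ A B, ChainAdj (T.refine E) A B → ∀ x ∈ B, u x - x ∈ A := by
    intro A B hAB x hx
    obtain ⟨z, ⟨hzB, hz⟩, m, ⟨hmB, hm⟩, rfl⟩ := Submodule.mem_sup.1 (hWD B hAB.2.1 hx)
    have h1 : (uK ⟨z, hz⟩ : Q) - z ∈ A := by
      obtain ⟨z', hz', h⟩ := hg.Ψ_mem A B hAB ⟨z, hz⟩ (gK ⟨z, hz⟩) hzB rfl
      have h3 : (gK (uK ⟨z, hz⟩) - gK ⟨z, hz⟩ : Q) ∈ A := by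
        refine T.mem_of_Ψ_eq_zero (L := A) (x := gK (uK ⟨z, hz⟩) - gK ⟨z, hz⟩) fun y hy => ?_
        have hy' : g.symm y ∈ T.annSub A := by
          rwa [← g.apply_mem_iff_of_stable (hann A hAB.1), LinearEquiv.apply_symm_apply]
        have h4 := h (g.symm y)
        rw [← huK, hy' z' hz', LinearEquiv.apply_symm_apply] at h4
        simpa using h4
      rw [← hgL A hAB.1, map_sub]
      exact h3
    have h2 : uW m - m ∈ A := by
      obtain ⟨w, hw, hwm⟩ := hg.Φ_mem A B hAB m hmB
      -- A `p`-th root `γ` of `c` moves the factor inside `Φ`. Then `γ • (uW m - m)` and `g.symm w`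
      -- agree modulo Ker Φ, so the former is the `W`-component of the latter.
      obtain ⟨γ, rfl⟩ := (bijective_frobenius k p).surjective c
      have hγ : γ ≠ 0 := fun h => hc (by rw [h, map_zero])
      have h3 : γ • (uW m - m) - g.symm w ∈ LinearMap.ker T.Φ := by
        rw [← hgK, LinearMap.mem_ker, map_sub, map_sub, LinearEquiv.apply_symm_apply, hwm, map_smul,
          LinearMap.map_smulₛₗ, map_sub, map_sub, smul_sub, huW, sub_self]
      have hw' : g.symm w ∈ A := by
        rwa [← hgL A hAB.1, LinearEquiv.apply_symm_apply]
      obtain ⟨a₁, ha₁, a₂, ha₂, ha⟩ := Submodule.mem_sup.1 (hWD A hAB.1 hw')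
      have h4 : γ • (uW m - m) - a₂ = 0 := by
        refine hW0 _ ?_ (W.sub_mem (W.smul_mem _ (W.sub_mem (huWW m) hm)) ha₂.2)
        have := Submodule.add_mem _ h3 ha₁.2
        rwa [← ha, show γ • (uW m - m) - (a₁ + a₂) + a₁ = γ • (uW m - m) - a₂ by abel] at this
      rw [← Submodule.smul_mem_iff A hγ, sub_eq_zero.1 h4]
      exact ha₂.1
    rw [hu ⟨z, hz⟩ m hm, add_sub_add_comm]
    exact A.add_mem h1 h2
  have huinj : Function.Injective u :=
    injective_of_chain_scalar hD hDbot hDtop u (fun _ => 1) (fun _ => one_ne_zero)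
      fun A B hAB _ x hx => by simpa using hulow A B hAB x hx
  have hust : ∀ L ∈ T.refine E, ∀ x ∈ L, u x ∈ L := fun L hL x hx => by
    simpa using L.add_mem (hulow L L (ChainAdj.refl hD hL) x hx) hx
  refine ⟨(LinearEquiv.ofInjectiveEndo u huinj).trans g, ?_, ?_, ?_, ?_⟩
  · intro x hx
    exact hg.ker_mem _ (by simp [hu_ker ⟨x, hx⟩])
  · intro L hL x hx
    exact hg.apply_mem L (hsub hL) _ (hust L (hsub hL) x hx)
  · intro A B hAB x hx
    change g (u (T.Φ x)) - c • T.Φ (g (u x)) ∈ _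
    -- The error is now g((u − 1)Φx), and u − 1 maps Φ(B) into Φ(A) because these are adjacent in
    -- the refined chain.
    rw [huΦ, ← map_sub]
    exact hg.apply_mem _ (map_mem_refine hAB.1) _
      (hulow _ _ (chainAdj_map hAB) _ ⟨x, hx, rfl⟩)
  · intro A B hAB x x' hx hx'
    -- The error is −d·Ψ(x)((u − 1)y). It vanishes for y in `T.annSub A`, since u − 1 maps this into
    -- `T.annSub B`.
    obtain ⟨z, hz, h⟩ := T.exists_Ψ_eq (L := A)
      (-(d • ((T.Ψ x : Module.Dual k Q) ∘ₗ (u - LinearMap.id)))) (by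
        intro y hy
        have := hulow _ _ (chainAdj_annSub hAB) y hy x hx
        simp only [map_sub] at this
        simp [this])
    refine ⟨z, hz, fun y => ?_⟩
    have hx'' : x' = gK (uK x) := Subtype.ext (by
      rw [hx']
      change g (u x) = g (uK x)
      rw [hu_ker])
    change _ - (T.Ψ x' : Module.Dual k Q) (g (u y)) = _
    rw [hx'', huK, h]
    simp
    ring

/-! ### Leading-order solution on a stable chain -/

/-- On a chain stable under refinement there are scalars on the graded pieces that are compatible
with `Φ` and `Ψ` up to the factors `c` and `d`. -/
theorem exists_scalars [IsAlgClosed k] (hD : IsChain (· ≤ ·) D) (hsub : T.refine D ⊆ D)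
    (c d : kˣ) : ∃ a : Submodule k Q → kˣ, ∀ A B, ChainAdj D A B →
      (¬ B.map T.Φ ≤ A.map T.Φ → a (B.map T.Φ) = c * a B ^ p) ∧
      (¬ T.annSub A ≤ T.annSub B → d = a B ^ p * a (T.annSub A)) := by
  classical
  have hlt : ∀ {A B A' B'}, ChainAdj D A B → ChainAdj D A' B' → B = B' ∨ B ≤ A' ∨ B' ≤ A := by
    intro A B A' B' h h'
    rcases h'.2.2 B h.2.1 with h1 | h1
    · exact Or.inr (Or.inl h1)
    · rcases h.2.2 B' h'.2.1 with h2 | h2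
      · exact Or.inr (Or.inr h2)
      · exact Or.inl (le_antisymm h2 h1)
  -- Each `M` is subject to at most one equation: a jump determines its upper member, and images lie
  -- below all annihilators, so `M` cannot carry conditions of both kinds. An unconstrained `M` gets
  -- exponent 0 and value 1.
  have hex : ∀ M : D, ∃ (s : D) (e : ℤ) (t : kˣ), (p : ℤ) ∣ e ∧
      (∀ A B, ChainAdj D A B → B.map T.Φ = M → ¬ B.map T.Φ ≤ A.map T.Φ →
        (s : Submodule k Q) = B ∧ e = p ∧ t = c) ∧
      (∀ A B, ChainAdj D A B → T.annSub A = M → ¬ T.annSub A ≤ T.annSub B →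
        (s : Submodule k Q) = B ∧ e = -p ∧ t = d) := by
    rintro ⟨M, hM⟩
    by_cases h1 : ∃ A B, ChainAdj D A B ∧ B.map T.Φ = M ∧ ¬ B.map T.Φ ≤ A.map T.Φ
    · obtain ⟨A, B, hAB, rfl, hne⟩ := h1
      refine ⟨⟨B, hAB.2.1⟩, p, c, dvd_rfl, fun A' B' hAB' heq hne' => ⟨?_, rfl, rfl⟩,
        fun A' B' _ heq hne' => ?_⟩
      · rcases hlt hAB hAB' with h | h | h
        · exact h
        · exact absurd (heq.le.trans (Submodule.map_mono h)) hne'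
        · exact absurd (heq.ge.trans (Submodule.map_mono h)) hne
      · exact absurd (heq.le.trans (T.map_le_annSub B B')) hne'
    by_cases h2 : ∃ A B, ChainAdj D A B ∧ T.annSub A = M ∧ ¬ T.annSub A ≤ T.annSub B
    · obtain ⟨A, B, hAB, rfl, hne⟩ := h2
      refine ⟨⟨B, hAB.2.1⟩, -p, d, (dvd_neg.2 dvd_rfl), fun A' B' hAB' heq hne' => ?_,
        fun A' B' hAB' heq hne' => ⟨?_, rfl, rfl⟩⟩
      · exact absurd ⟨A', B', hAB', heq, hne'⟩ h1
      · rcases hlt hAB hAB' with h | h | h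
        · exact h
        · exact absurd (heq.ge.trans (T.annSub_antitone h)) hne
        · exact absurd (heq.le.trans (T.annSub_antitone h)) hne'
    · exact ⟨⟨M, hM⟩, 0, 1, dvd_zero _, fun A B h h' h'' => absurd ⟨A, B, h, h', h''⟩ h1,
        fun A B h h' h'' => absurd ⟨A, B, h, h', h''⟩ h2⟩
  choose s e t he hΦ hΨ using hex
  have : Finite D := finite_of_isChain hD
  obtain ⟨a, ha⟩ := exists_units_eq_mul_zpow p s e he t
  have hdif : ∀ L (h : L ∈ D), (fun L => if h : L ∈ D then a ⟨L, h⟩ else 1) L = a ⟨L, h⟩ :=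
    fun L h => dif_pos h
  refine ⟨fun L => if h : L ∈ D then a ⟨L, h⟩ else 1, fun A B hAB => ⟨fun hne => ?_, fun hne => ?_⟩⟩
  · have hM := hsub (map_mem_refine (T := T) hAB.2.1)
    obtain ⟨h1, h2, h3⟩ := hΦ ⟨_, hM⟩ A B hAB rfl hne
    rw [hdif _ hM, hdif _ hAB.2.1, ha ⟨_, hM⟩, h2, h3,
      show s ⟨_, hM⟩ = ⟨B, hAB.2.1⟩ from Subtype.ext h1,
      zpow_natCast]
  · have hM := hsub (annSub_mem_refine (T := T) hAB.1)
    obtain ⟨h1, h2, h3⟩ := hΨ ⟨_, hM⟩ A B hAB rfl hne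
    rw [hdif _ hM, hdif _ hAB.2.1, ha ⟨_, hM⟩, h2, h3,
      show s ⟨_, hM⟩ = ⟨B, hAB.2.1⟩ from Subtype.ext h1,
      zpow_neg, zpow_natCast, mul_comm d, mul_inv_cancel_left]

/-- Stability makes the image and annihilator pairs of adjacent members adjacent in `D` itself, so
`g` acts on them by known scalars and the leading terms cancel. Where the induced graded map
vanishes, the condition follows from `g` preserving the chain. -/
theorem exists_isIsoMod_of_refine_eq [IsAlgClosed k] (hD : IsChain (· ≤ ·) D) (hbot : ⊥ ∈ D)
    (htop : ⊤ ∈ D) (hst : T.refine D = D) (c d : kˣ) :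
    ∃ g : Q ≃ₗ[k] Q, T.IsIsoMod c d D g := by
  obtain ⟨a, ha⟩ := exists_scalars hD hst.subset c d
  obtain ⟨g, hgK, hg⟩ := exists_chain_scalar hD hbot htop (LinearMap.ker T.Φ) fun L => (a L : k)
  have hginj := injective_of_chain_scalar hD hbot htop g _ (fun L => (a L).ne_zero) hg
  have hmem : ∀ L ∈ D, ∀ x ∈ L, g x ∈ L := fun L hL x hx => chain_mem_of_scalar hD hbot hg hL hx
  have hg' : ∀ A B, ChainAdj D A B → ¬ B ≤ A → ∀ x ∈ B, g x - (a B : k) • x ∈ A :=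
    fun A B h h' => hg A B h (lt_of_le_not_ge ((hD.total h.1 h.2.1).resolve_right h') h')
  refine ⟨LinearEquiv.ofInjectiveEndo g hginj, hgK, hmem, ?_, ?_⟩
  · intro A B hAB x hx
    change g (T.Φ x) - (c : k) • T.Φ (g x) ∈ A.map T.Φ
    have hadj : ChainAdj D (A.map T.Φ) (B.map T.Φ) := hst ▸ chainAdj_map (T := T) hAB
    by_cases hle : B.map T.Φ ≤ A.map T.Φ
    · exact hle (Submodule.sub_mem _ (hmem _ hadj.2.1 _ ⟨x, hx, rfl⟩)
        (Submodule.smul_mem _ _ ⟨g x, hmem B hAB.2.1 x hx, rfl⟩))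
    · have h1 := hg' _ _ hadj hle (T.Φ x) ⟨x, hx, rfl⟩
      have h2 : T.Φ (g x - (a B : k) • x) ∈ A.map T.Φ :=
        ⟨_, hg' A B hAB (fun h => hle (Submodule.map_mono h)) x hx, rfl⟩
      have h3 := Submodule.sub_mem _ h1 (Submodule.smul_mem _ (c : k) h2)
      rw [(ha A B hAB).1 hle] at h3
      convert h3 using 1
      rw [map_sub, LinearMap.map_smulₛₗ, frobenius_def, smul_sub, smul_smul]
      push_cast
      abel
  · intro A B hAB x x' hx hx'
    change (x' : Q) = g x at hx'
    have hadj : ChainAdj D (T.annSub B) (T.annSub A) := hst ▸ chainAdj_annSub (T := T) hAB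
    have hxB' : (x' : Q) ∈ B := hx' ▸ hmem B hAB.2.1 x hx
    obtain ⟨z, hz, h⟩ := T.exists_Ψ_eq (L := A) ((d : k) • (T.Ψ x : Module.Dual k Q) -
        (T.Ψ x' : Module.Dual k Q) ∘ₗ g) (by
      intro y hy
      change (d : k) * (T.Ψ x : Module.Dual k Q) y - (T.Ψ x' : Module.Dual k Q) (g y) = 0
      have hgy := hmem _ hadj.2.1 y hy
      by_cases hle : T.annSub A ≤ T.annSub B
      · rw [hle hy x hx, hle hgy x' hxB', mul_zero, sub_zero]
      · have h1 := hg' A B hAB (fun h => hle (T.annSub_antitone h)) x hx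
        have h2 := hg' _ _ hadj hle y hy x hx
        rw [map_sub, map_smul, smul_eq_mul, sub_eq_zero] at h2
        have h3 := hgy (x' - (a B : k) • x) (by simpa [hx'] using h1)
        simp only [map_sub, LinearMap.map_smulₛₗ, frobenius_def, Submodule.coe_sub,
          Submodule.coe_smul, LinearMap.sub_apply, LinearMap.smul_apply, smul_eq_mul,
          sub_eq_zero] at h3
        rw [h3, h2, (ha A B hAB).2 hle]
        push_cast
        ring)
    refine ⟨z, hz, fun y => ?_⟩
    rw [h]
    rfl

/-! ### Stabilisation of the refinements and descent to the trivial chain -/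

theorem iterate_refine_spec (T : HWTriple p k Q) (n : ℕ) :
    IsChain (· ≤ ·) (T.refine^[n] {⊥, ⊤}) ∧ ⊥ ∈ T.refine^[n] {⊥, ⊤} ∧
      T.refine^[n] {⊥, ⊤} ⊆ T.refine (T.refine^[n] {⊥, ⊤}) := by
  induction n with
  | zero =>
    refine ⟨?_, by simp, ?_⟩
    · rintro X (rfl | rfl) Y (rfl | rfl) - <;> simp
    rintro _ (rfl | rfl)
    · exact bot_mem_refine (by simp)
    · exact top_mem_refine (by simp)
  | succ n ih =>
    rw [Function.iterate_succ_apply']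
    exact ⟨isChain_refine ih.1, bot_mem_refine ih.2.1, refine_mono ih.2.2⟩

theorem top_mem_iterate_refine (T : HWTriple p k Q) (n : ℕ) : ⊤ ∈ T.refine^[n] {⊥, ⊤} := by
  cases n with
  | zero => simp
  | succ n =>
    rw [Function.iterate_succ_apply']
    exact top_mem_refine (T.iterate_refine_spec n).2.1

theorem exists_iterate_refine_stable (T : HWTriple p k Q) : ∃ n,
    T.refine (T.refine^[n] {⊥, ⊤}) = T.refine^[n] {⊥, ⊤} := by
  have hmono : Monotone fun n => T.refine^[n] {⊥, ⊤} := monotone_nat_of_le_succ fun n => by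
    rw [Function.iterate_succ_apply']
    exact (T.iterate_refine_spec n).2.2
  -- Members of a chain are determined by their dimensions, so the increasing sequence of chains can
  -- be tracked by subsets of a fixed finite set.
  let S : ℕ →o Set (Fin (Module.finrank k Q + 1)) :=
    ⟨fun n => {i | ∃ L ∈ T.refine^[n] {⊥, ⊤}, Module.finrank k L = i},
      fun m n h i ⟨L, hL, hi⟩ => ⟨L, hmono h hL, hi⟩⟩
  obtain ⟨n, hn⟩ := WellFoundedGT.monotone_chain_condition S
  refine ⟨n, Set.Subset.antisymm (fun L hL => ?_) (T.iterate_refine_spec n).2.2⟩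
  rw [← Function.iterate_succ_apply' T.refine] at hL
  have h1 : (⟨Module.finrank k L, Nat.lt_succ_of_le (Submodule.finrank_le L)⟩ :
      Fin (Module.finrank k Q + 1)) ∈ S n := by
    rw [hn (n + 1) n.le_succ]
    exact ⟨L, hL, rfl⟩
  obtain ⟨L', hL', h2⟩ := h1
  rwa [← finrank_injOn_chain (T.iterate_refine_spec (n + 1)).1 (hmono n.le_succ hL') hL h2]

/-- Stability is needed only to start at the last refinement; each correction then goes back one
refinement. -/
theorem exists_isIsoMod_bot_top [IsAlgClosed k] (T : HWTriple p k Q) (c d : kˣ) :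
    ∃ g : Q ≃ₗ[k] Q, T.IsIsoMod c d {⊥, ⊤} g := by
  obtain ⟨n, hn⟩ := T.exists_iterate_refine_stable
  have hbase : ∃ g : Q ≃ₗ[k] Q, T.IsIsoMod c d (T.refine^[n] {⊥, ⊤}) g :=
    exists_isIsoMod_of_refine_eq (T.iterate_refine_spec n).1 (T.iterate_refine_spec n).2.1
      (T.top_mem_iterate_refine n) hn c d
  clear hn
  induction n with
  | zero => exact hbase
  | succ n ih =>
    obtain ⟨hch, hbot, hsub⟩ := T.iterate_refine_spec n
    obtain ⟨g, hg⟩ := hbase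
    rw [Function.iterate_succ_apply'] at hg
    exact ih (hg.exists_of_refine c.ne_zero hch hbot (T.top_mem_iterate_refine n) hsub)

/-- Rescaling `Φ` and `Ψ` by nonzero constants does not change the isomorphism class of a
Hasse–Witt triple over an algebraically closed field. -/
theorem exists_equiv_rescale [IsAlgClosed k] (T : HWTriple p k Q) (c d : kˣ) :
    ∃ g : Q ≃ₗ[k] Q, (∀ x, g (T.Φ x) = (c : k) • T.Φ (g x)) ∧
      ∀ x x' : LinearMap.ker T.Φ, (x' : Q) = g x → ∀ y,
        (T.Ψ x' : Module.Dual k Q) (g y) = d * (T.Ψ x : Module.Dual k Q) y := by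
  obtain ⟨g, hg⟩ := T.exists_isIsoMod_bot_top c d
  have hadj : ChainAdj ({⊥, ⊤} : Set (Submodule k Q)) ⊥ ⊤ := ⟨by simp, by simp, by simp⟩
  refine ⟨g, fun x => ?_, fun x x' hx' y => ?_⟩
  · have := hg.Φ_mem _ _ hadj x trivial
    rwa [Submodule.map_bot, Submodule.mem_bot, sub_eq_zero] at this
  · obtain ⟨z, hz, h⟩ := hg.Ψ_mem _ _ hadj x x' trivial hx'
    have hz0 : z = 0 := Subtype.ext ((Submodule.mem_bot k).1 hz)
    have := h y
    rw [hz0, map_zero, Submodule.coe_zero, LinearMap.zero_apply, sub_eq_zero] at this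
    exact this.symm

end HWTriple

theorem proposition2p8 (p : ℕ) [Fact p.Prime] (k : Type*) [Field k] [CharP k p] [IsAlgClosed k]
    (Q₁ Q₂ : Type*) [AddCommGroup Q₁] [Module k Q₁] [FiniteDimensional k Q₁]
    [AddCommGroup Q₂] [Module k Q₂] [FiniteDimensional k Q₂]
    (T₁ : HWTriple p k Q₁) (T₂ : HWTriple p k Q₂) (h : T₁.Equivalent T₂) :
    T₁.Isomorphic T₂ := by
  obtain ⟨f, c, d, hc, hd, hΦ, hΨ⟩ := h
  -- The factor for `Ψ` is inverted because `hΨ` contributes `d` on the side of `g x`, whereas `hΦ`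
  -- contributes a `c` that `hgΦ` absorbs directly.
  obtain ⟨g, hgΦ, hgΨ⟩ := T₁.exists_equiv_rescale (Units.mk0 c hc) (Units.mk0 d hd)⁻¹
  refine ⟨g.trans f, fun x => ?_, fun x => ?_⟩
  · rw [LinearEquiv.trans_apply, LinearEquiv.trans_apply, hΦ, hgΦ, one_smul, map_smul,
      Units.val_mk0]
  · have hx : g x ∈ LinearMap.ker T₁.Φ := by
      have h1 := hgΦ x
      rw [LinearMap.mem_ker.1 x.2, map_zero, Units.val_mk0] at h1
      exact (smul_eq_zero.1 h1.symm).resolve_left hc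
    refine (hΨ ⟨g x, hx⟩).trans ?_
    rw [one_smul]
    refine LinearMap.ext fun y => ?_
    have h2 := hgΨ x ⟨g x, hx⟩ rfl (g.symm (f.symm y))
    rw [LinearEquiv.apply_symm_apply] at h2
    change d * (T₁.Ψ ⟨g x, hx⟩ : Module.Dual k Q₁) (f.symm y) =
      (T₁.Ψ x : Module.Dual k Q₁) (g.symm (f.symm y))
    rw [h2]
    simp [hd]
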